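/- For $n\ge 0$ let $\Pi_n$ be the set of set partitions of $\{1,\dots,n\}$. An edge of $\pi\in\Pi_n$ is a pair $(i,j)$, $i<j$, of consecutive elements of one block of $\pi$ (that is, $i$ and $j$ lie in the same block, and no element of that block lies strictly between them). Let $\mathrm{cr}(\pi)$ (resp. $\mathrm{ne}(\pi)$) be the number of pairs of edges $(i_1,j_1),(i_2,j_2)$ of $\pi$ with $i_1<i_2<j_1<j_2$ (resp. $i_1<i_2<j_2<j_1$). Let $[k]_{p,q}=\frac{p^k-q^k}{p-q}=\sum_{i=0}^{k-1}p^iq^{k-1-i}$. Then, as formal power series in $z$, with $p,q$ indeterminates or arbitrary elements of a commutative ring, $$\sum_{n\ge0}\Big(\sum_{\pi\in\Pi_n}p^{\mathrm{cr}(\pi)}q^{\mathrm{ne}(\pi)}\Big)z^n=\sum_{n\ge0}\Big(\sum_{\pi\in\Pi_n}q^{\mathrm{cr}(\pi)}p^{\mathrm{ne}(\pi)}\Big)z^n,$$ and this series has the continued fraction expansion $$\cfrac{1}{1-z-\cfrac{z^2}{1-([1]_{p,q}+1)z-\cfrac{[2]_{p,q}z^2}{1-([2]_{p,q}+1)z-\cfrac{[3]_{p,q}z^2}{1-([3]_{p,q}+1)z-\cfrac{[4]_{p,q}z^2}{\ddots}}}}},$$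 with denominator $1-([k]_{p,q}+1)z$ at level $k\ge0$, followed by the numerator $[k+1]_{p,q}z^2$; that is, for every $n$ the coefficient of $z^n$ in the finite continued fraction truncated at level $N$ (whose innermost denominator is $1-([N]_{p,q}+1)z$) equals that of the series for all sufficiently large $N$. -/

import Mathlib

namespace CrossNest

open PowerSeries

/-- The edges of the partition graph of a set partition `P`: the pairs `(i, j)` with `i < j` such
that `i` and `j` are consecutive elements of the same block. -/
def edges {s : Finset ℕ} (P : Finpartition s) : Finset (ℕ × ℕ) :=
  (s ×ˢ s).filter fun e =>
    ∃ B ∈ P.parts, e.1 ∈ B ∧ e.2 ∈ B ∧ e.1 < e.2 ∧ ∀ k ∈ B, ¬ (e.1 < k ∧ k < e.2)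

/-- The number of crossings: a pair of edges `(i₁, j₁)`, `(i₂, j₂)` with `i₁ < i₂ < j₁ < j₂`.
The inequalities determine which edge is the first one, so no pair is counted twice. -/
def cr {s : Finset ℕ} (P : Finpartition s) : ℕ :=
  ((edges P ×ˢ edges P).filter fun e =>
    e.1.1 < e.2.1 ∧ e.2.1 < e.1.2 ∧ e.1.2 < e.2.2).card

/-- The number of nestings: a pair of edges `(i₁, j₁)`, `(i₂, j₂)` with `i₁ < i₂ < j₂ < j₁`. -/
def ne {s : Finset ℕ} (P : Finpartition s) : ℕ :=
  ((edges P ×ˢ edges P).filter fun e =>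
    e.1.1 < e.2.1 ∧ e.2.1 < e.2.2 ∧ e.2.2 < e.1.2).card

variable {R : Type*} [CommRing R]

/-- The polynomial `∑_π p ^ cr(π) * q ^ ne(π)`, over all set partitions `π` of `{1, …, n}`. -/
def crNePoly (p q : R) (n : ℕ) : R :=
  ∑ P : Finpartition (Finset.Icc 1 n), p ^ cr P * q ^ ne P

/-- `[n]_{p,q} = (p ^ n - q ^ n) / (p - q)`, as a polynomial in `p` and `q`. -/
def pqNat (p q : R) (n : ℕ) : R :=
  ∑ i ∈ Finset.range n, p ^ i * q ^ (n - 1 - i)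

theorem pqNat_mul_sub (p q : R) (n : ℕ) : pqNat p q n * (p - q) = p ^ n - q ^ n :=
  (Commute.all p q).geom_sum₂_mul n

/-- The finite J-fraction with `N + 1` levels, starting at level `k`:
`1 / (1 - b k z - c k z² / (1 - b (k+1) z - c (k+1) z² / (⋯ / (1 - b (k+N) z))))`.
All denominators have constant coefficient `1`, so `invOfUnit · 1` is their inverse. -/
noncomputable def jFractionConvergent (b c : ℕ → R) : ℕ → ℕ → R⟦X⟧
  | 0, k => invOfUnit (1 - C (b k) * X) 1
  | N + 1, k =>
      invOfUnit (1 - C (b k) * X - C (c k) * X ^ 2 * jFractionConvergent b c N (k + 1)) 1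

theorem jFractionConvergent_zero (b c : ℕ → R) (k : ℕ) :
    (1 - C (b k) * X) * jFractionConvergent b c 0 k = 1 := by
  rw [jFractionConvergent]
  exact mul_invOfUnit _ _ (by simp)

theorem jFractionConvergent_succ (b c : ℕ → R) (N k : ℕ) :
    (1 - C (b k) * X - C (c k) * X ^ 2 * jFractionConvergent b c N (k + 1)) *
      jFractionConvergent b c (N + 1) k = 1 := by
  rw [jFractionConvergent]
  exact mul_invOfUnit _ _ (by simp)

/-- The formal power series `F` is given by the infinite J-fraction
`1 / (1 - b 0 z - c 0 z² / (1 - b 1 z - c 1 z² / ⋯))`: its convergents converge to `F` formally,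
that is, every coefficient of `F` is the eventual value of that coefficient of the convergents. -/
def HasJFraction (F : R⟦X⟧) (b c : ℕ → R) : Prop :=
  ∀ n : ℕ, ∃ N₀ : ℕ, ∀ N ≥ N₀, coeff n (jFractionConvergent b c N 0) = coeff n F

end CrossNest

/-!
The edges of a set partition form a set of arcs in which every element starts at most one arc and
ends at most one arc, and every such set of arcs arises from exactly one partition. Read the
elements from left to right and keep track of the arcs that are still open, as arcs with their right
end at infinity. A new greatest element `a` may close one open arc, and then may start a new open
arc. Closing the open arc that starts at `i` creates one crossing with each open arc that starts to
the right of `i` and one nesting with each open arc that starts to its left. So closing one out of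
`k` open arcs contributes `∑ p ^ (k - 1 - m) * q ^ m = [k]_{p,q}` in total, and the partitions are
counted by Motzkin paths whose height is the number of open arcs: up steps have weight `1`, level
steps at height `k` have weight `[k]_{p,q} + 1`, and down steps from height `k` have weight
`[k]_{p,q}`. Since `[k]_{p,q}` is symmetric in `p` and `q`, so is the count. The generating
functions of the paths that end at a given height satisfy a three-term recurrence, which expands
into the J-fraction.
-/

namespace CrossNest

open Finset PowerSeries

section MotzkinPaths

section Weight

variable {R : Type*} [Semiring R]

/-- The total weight of the Motzkin paths of length `n` from height `0` to height `h`: up steps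
have weight `1`, level steps at height `k` weight `b k`, down steps from height `k + 1` to height
`k` weight `c k`. The recursion removes the last step. -/
def motzkinWeight (b c : ℕ → R) : ℕ → ℕ → R
  | 0, 0 => 1
  | 0, _ + 1 => 0
  | n + 1, 0 => b 0 * motzkinWeight b c n 0 + c 0 * motzkinWeight b c n 1
  | n + 1, h + 1 => motzkinWeight b c n h + b (h + 1) * motzkinWeight b c n (h + 1) +
      c (h + 1) * motzkinWeight b c n (h + 2)

/-- The generating function, by length, of the weighted Motzkin paths from height `0` to height
`h`. -/
noncomputable def motzkinSeries (b c : ℕ → R) (h : ℕ) : R⟦X⟧ :=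
  PowerSeries.mk fun n => motzkinWeight b c n h

theorem motzkinSeries_zero (b c : ℕ → R) :
    motzkinSeries b c 0 =
      1 + X * (C (b 0) * motzkinSeries b c 0 + C (c 0) * motzkinSeries b c 1) := by
  ext (_ | n)
  · simp [motzkinSeries, motzkinWeight]
  · simp [motzkinSeries, motzkinWeight, coeff_succ_X_mul, coeff_one]

theorem motzkinSeries_succ (b c : ℕ → R) (h : ℕ) :
    motzkinSeries b c (h + 1) =
      X * motzkinSeries b c h +
        X * (C (b (h + 1)) * motzkinSeries b c (h + 1) +
          C (c (h + 1)) * motzkinSeries b c (h + 2)) := by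
  ext (_ | n)
  · simp [motzkinSeries, motzkinWeight]
  · simp [motzkinSeries, motzkinWeight, coeff_succ_X_mul, add_assoc]

end Weight

variable {R : Type*} [CommRing R] {b c : ℕ → R}

theorem X_pow_dvd_sub_jFractionConvergent_mul {F U : ℕ → R⟦X⟧}
    (hF : ∀ k, F k = U k + X * (C (b k) * F k + C (c k) * F (k + 1)))
    (hU : ∀ k, U (k + 1) = X * F k) (N k : ℕ) :
    X ^ (N + 1) ∣ F k - jFractionConvergent b c N k * U k := by
  induction N generalizing k with
  | zero =>
    refine ⟨jFractionConvergent b c 0 k * (C (c k) * F (k + 1)), ?_⟩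
    linear_combination jFractionConvergent b c 0 k * hF k - F k * jFractionConvergent_zero b c k
  | succ N ih =>
    obtain ⟨V, hV⟩ := ih (k + 1)
    rw [hU] at hV
    refine ⟨jFractionConvergent b c (N + 1) k * (C (c k) * V), ?_⟩
    linear_combination jFractionConvergent b c (N + 1) k * hF k -
      F k * jFractionConvergent_succ b c N k +
      X * jFractionConvergent b c (N + 1) k * C (c k) * hV

theorem hasJFraction_of_contiguous {F U : ℕ → R⟦X⟧}
    (hF : ∀ k, F k = U k + X * (C (b k) * F k + C (c k) * F (k + 1)))
    (hU : ∀ k, U (k + 1) = X * F k) (hU₀ : U 0 = 1) : HasJFraction (F 0) b c := by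
  refine fun n => ⟨n, fun N hN => ?_⟩
  have hdvd := X_pow_dvd_sub_jFractionConvergent_mul hF hU N 0
  rw [hU₀, mul_one, X_pow_dvd_iff] at hdvd
  have hcoeff := hdvd n (Nat.lt_succ_of_le hN)
  rw [map_sub, sub_eq_zero] at hcoeff
  exact hcoeff.symm

theorem hasJFraction_motzkinSeries (b c : ℕ → R) : HasJFraction (motzkinSeries b c 0) b c :=
  hasJFraction_of_contiguous (F := motzkinSeries b c)
    (U := fun | 0 => 1 | h + 1 => X * motzkinSeries b c h)
    (fun | 0 => motzkinSeries_zero b c | h + 1 => motzkinSeries_succ b c h)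
    (fun _ => rfl) rfl

end MotzkinPaths

section PQNumbers

variable {R : Type*} [CommRing R] (p q : R)

theorem pqNat_comm (n : ℕ) : pqNat p q n = pqNat q p n :=
  geom_sum₂_comm p q n

theorem pqNat_succ (n : ℕ) : pqNat p q (n + 1) = p ^ n + q * pqNat p q n :=
  geom_sum₂_succ_eq p q

theorem sum_pow_card_gt_mul_pow_card_lt (O : Finset ℕ) :
    ∑ i ∈ O, p ^ #{o ∈ O | i < o} * q ^ #{o ∈ O | o < i} = pqNat p q #O := by
  induction O using Finset.induction_on_min with
  | empty => simp [pqNat]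
  | insert a O ha ih =>
    have haO : a ∉ O := fun h => (ha a h).false
    have hmin : p ^ #{o ∈ insert a O | a < o} * q ^ #{o ∈ insert a O | o < a} = p ^ #O := by
      rw [filter_insert, filter_insert, if_neg (lt_irrefl a), if_neg (lt_irrefl a),
        filter_true_of_mem ha, filter_false_of_mem fun o ho => (ha o ho).not_gt, card_empty,
        pow_zero, mul_one]
    have hrest : ∀ i ∈ O, p ^ #{o ∈ insert a O | i < o} * q ^ #{o ∈ insert a O | o < i} =
        q * (p ^ #{o ∈ O | i < o} * q ^ #{o ∈ O | o < i}) := fun i hi => by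
      rw [filter_insert, filter_insert, if_neg (ha i hi).not_gt, if_pos (ha i hi),
        card_insert_of_notMem (by simp [haO]), pow_succ]
      ring
    rw [sum_insert haO, hmin, sum_congr rfl hrest, ← mul_sum, ih, card_insert_of_notMem haO,
      pqNat_succ]

end PQNumbers

section ArcDiagrams

/-- An arc diagram on `s`: a set of arcs between elements of `s`, directed from left to right, in
which every element starts at most one arc and ends at most one arc. These are the sets of edges
of the set partitions of `s`. -/
structure IsArcDiagram (s : Finset ℕ) (E : Finset (ℕ × ℕ)) : Prop where
  fst_mem : ∀ e ∈ E, e.1 ∈ s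
  snd_mem : ∀ e ∈ E, e.2 ∈ s
  fst_lt_snd : ∀ e ∈ E, e.1 < e.2
  fst_injOn : Set.InjOn Prod.fst (E : Set (ℕ × ℕ))
  snd_injOn : Set.InjOn Prod.snd (E : Set (ℕ × ℕ))

/-- The elements of `s` at which no arc of `E` starts. When `E` is the set of edges of a set
partition of `s`, these are the greatest elements of its blocks. -/
def sinks (s : Finset ℕ) (E : Finset (ℕ × ℕ)) : Finset ℕ :=
  s \ E.image Prod.fst

variable {s : Finset ℕ} {E : Finset (ℕ × ℕ)} {a i : ℕ}

theorem mem_sinks : i ∈ sinks s E ↔ i ∈ s ∧ ∀ e ∈ E, e.1 ≠ i := by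
  simp only [sinks, mem_sdiff, mem_image, not_exists, not_and, ne_eq]

theorem sinks_insert (hE : ∀ e ∈ E, e.1 ≠ a) : sinks (insert a s) E = insert a (sinks s E) := by
  ext x
  simp only [mem_sinks, mem_insert]
  grind

theorem sinks_insert_arc (s : Finset ℕ) (E : Finset (ℕ × ℕ)) (e : ℕ × ℕ) :
    sinks s (insert e E) = (sinks s E).erase e.1 := by
  rw [sinks, image_insert, sdiff_insert, sinks]

theorem IsArcDiagram.snd_lt (hE : IsArcDiagram s E) (ha : ∀ x ∈ s, x < a) :
    ∀ e ∈ E, e.2 < a :=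
  fun e he => ha _ (hE.snd_mem e he)

theorem IsArcDiagram.mk_notMem (hE : IsArcDiagram s E) (ha : a ∉ s) (i : ℕ) : (i, a) ∉ E :=
  fun h => ha (hE.snd_mem _ h)

theorem isArcDiagram_insert_iff (ha : ∀ x ∈ s, x < a) (hE : ∀ i, (i, a) ∉ E) :
    IsArcDiagram (insert a s) E ↔ IsArcDiagram s E := by
  refine ⟨fun h => ⟨fun e he => ?_, fun e he => ?_, h.fst_lt_snd, h.fst_injOn, h.snd_injOn⟩,
    fun h => ⟨fun e he => mem_insert_of_mem (h.fst_mem e he),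
      fun e he => mem_insert_of_mem (h.snd_mem e he), h.fst_lt_snd, h.fst_injOn, h.snd_injOn⟩⟩
  all_goals
    have := h.fst_mem e he
    have := h.snd_mem e he
    have := h.fst_lt_snd e he
    grind

theorem isArcDiagram_insert_arc_iff (ha : ∀ x ∈ s, x < a) (hi : (i, a) ∉ E) :
    IsArcDiagram (insert a s) (insert (i, a) E) ↔ IsArcDiagram s E ∧ i ∈ sinks s E := by
  have has : a ∉ s := fun h => (ha a h).false
  rw [mem_sinks]
  constructor
  · intro h
    have hE : IsArcDiagram (insert a s) E :=
      ⟨fun e he => h.fst_mem e (mem_insert_of_mem he),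
        fun e he => h.snd_mem e (mem_insert_of_mem he),
        fun e he => h.fst_lt_snd e (mem_insert_of_mem he),
        h.fst_injOn.mono (by simp), h.snd_injOn.mono (by simp)⟩
    have hstart : ∀ e ∈ E, e.1 ≠ i := fun e he hei => hi <|
      h.fst_injOn (mem_insert_of_mem he) (mem_insert_self _ E) hei ▸ he
    have hend : ∀ j, (j, a) ∉ E := fun j hj => hi <|
      h.snd_injOn (mem_insert_of_mem hj) (mem_insert_self _ E) rfl ▸ hj
    have his : i ∈ s := mem_of_mem_insert_of_ne (h.fst_mem _ (mem_insert_self _ E))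
      (h.fst_lt_snd _ (mem_insert_self _ E)).ne
    exact ⟨(isArcDiagram_insert_iff ha hend).1 hE, his, hstart⟩
  · rintro ⟨h, his, hstart⟩
    refine ⟨?_, ?_, ?_, ?_, ?_⟩
    · exact forall_mem_insert .. |>.2 ⟨mem_insert_of_mem his,
        fun e he => mem_insert_of_mem (h.fst_mem e he)⟩
    · exact forall_mem_insert .. |>.2 ⟨mem_insert_self a s,
        fun e he => mem_insert_of_mem (h.snd_mem e he)⟩
    · exact forall_mem_insert .. |>.2 ⟨ha i his, h.fst_lt_snd⟩
    · rw [coe_insert, Set.injOn_insert (mem_coe.not.2 hi)]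
      refine ⟨h.fst_injOn, ?_⟩
      rintro ⟨e, he, hei⟩
      exact hstart e he hei
    · rw [coe_insert, Set.injOn_insert (mem_coe.not.2 hi)]
      refine ⟨h.snd_injOn, ?_⟩
      rintro ⟨e, he, rfl⟩
      exact has (h.snd_mem e he)

open Classical in
/-- The finite set of all arc diagrams on `s`. -/
noncomputable def arcDiagrams (s : Finset ℕ) : Finset (Finset (ℕ × ℕ)) :=
  {E ∈ (s ×ˢ s).powerset | IsArcDiagram s E}

theorem mem_arcDiagrams : E ∈ arcDiagrams s ↔ IsArcDiagram s E := by
  simp only [arcDiagrams, mem_filter, mem_powerset, and_iff_right_iff_imp]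
  exact fun h e he => mem_product.2 ⟨h.fst_mem e he, h.snd_mem e he⟩

theorem arcDiagrams_empty : arcDiagrams ∅ = {∅} := by
  ext E
  rw [mem_arcDiagrams, mem_singleton]
  refine ⟨fun h => eq_empty_of_forall_notMem fun e he => notMem_empty _ (h.fst_mem e he), ?_⟩
  rintro rfl
  constructor <;> simp

theorem sum_arcDiagrams_insert {M : Type*} [AddCommMonoid M] (ha : ∀ x ∈ s, x < a)
    (f : Finset (ℕ × ℕ) → M) :
    ∑ E ∈ arcDiagrams (insert a s), f E =
      ∑ E ∈ arcDiagrams s, (f E + ∑ i ∈ sinks s E, f (insert (i, a) E)) := by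
  classical
  have has : a ∉ s := fun h => (ha a h).false
  have hfresh : ∀ {E}, E ∈ arcDiagrams s → ∀ i, (i, a) ∉ E := fun hE =>
    (mem_arcDiagrams.1 hE).mk_notMem has
  rw [sum_add_distrib, ← sum_filter_add_sum_filter_not _ fun E => ∀ i, (i, a) ∉ E, sum_sigma']
  congr 1
  · refine sum_congr (ext fun E => ?_) fun _ _ => rfl
    rw [mem_filter]
    refine ⟨fun ⟨hE, hend⟩ => ?_, fun hE => ⟨?_, hfresh hE⟩⟩
    · exact mem_arcDiagrams.2 ((isArcDiagram_insert_iff ha hend).1 (mem_arcDiagrams.1 hE))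
    · exact mem_arcDiagrams.2 ((isArcDiagram_insert_iff ha (hfresh hE)).2 (mem_arcDiagrams.1 hE))
  · symm
    refine sum_bij (fun x _ => insert (x.2, a) x.1) ?_ ?_ ?_ fun _ _ => rfl
    · rintro ⟨E, i⟩ hx
      obtain ⟨hE, hi⟩ := mem_sigma.1 hx
      rw [mem_filter, mem_arcDiagrams, isArcDiagram_insert_arc_iff ha (hfresh hE i)]
      exact ⟨⟨mem_arcDiagrams.1 hE, hi⟩, fun h => h i (mem_insert_self _ _)⟩
    · rintro ⟨E, i⟩ hx ⟨E', i'⟩ hx' h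
      have hE : ∀ j, (j, a) ∉ E := hfresh (mem_sigma.1 hx).1
      have hE' : ∀ j, (j, a) ∉ E' := hfresh (mem_sigma.1 hx').1
      dsimp only at h
      obtain rfl : i = i' := by
        have hi : (i, a) ∈ insert (i', a) E' := h ▸ mem_insert_self _ _
        simpa [hE' i] using hi
      obtain rfl : E = E' := by rw [← erase_insert (hE i), h, erase_insert (hE' i)]
      rfl
    · intro E hE
      obtain ⟨hE, hend⟩ := mem_filter.1 hE
      obtain ⟨i, hi⟩ : ∃ i, (i, a) ∈ E := by simpa using hend
      rw [mem_arcDiagrams, ← insert_erase hi,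
        isArcDiagram_insert_arc_iff ha (notMem_erase _ _)] at hE
      exact ⟨⟨E.erase (i, a), i⟩, mem_sigma.2 ⟨mem_arcDiagrams.2 hE.1, hE.2⟩, insert_erase hi⟩

end ArcDiagrams

section Edges

variable {s : Finset ℕ}

theorem mk_mem_edges {P : Finpartition s} {i j : ℕ} :
    (i, j) ∈ edges P ↔ j ∈ P.part i ∧ i < j ∧ ∀ k ∈ P.part i, ¬ (i < k ∧ k < j) := by
  simp only [edges, mem_filter, mem_product]
  constructor
  · rintro ⟨-, B, hB, hi, hj, hij, hbetween⟩
    rw [P.part_eq_of_mem hB hi]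
    exact ⟨hj, hij, hbetween⟩
  · rintro ⟨hj, hij, hbetween⟩
    have hi : i ∈ s := P.part_nonempty.1 ⟨j, hj⟩
    exact ⟨⟨hi, P.part_subset i hj⟩, P.part i, P.part_mem.2 hi, P.mem_part_self.2 hi, hj, hij,
      hbetween⟩

theorem part_eq_part_of_mem_part {α : Type*} [DecidableEq α] {s : Finset α} {P : Finpartition s}
    {x y : α} (h : y ∈ P.part x) : P.part y = P.part x :=
  P.part_eq_of_mem (P.part_mem.2 (P.part_nonempty.1 ⟨y, h⟩)) h

theorem isArcDiagram_edges (P : Finpartition s) : IsArcDiagram s (edges P) where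
  fst_mem := fun ⟨_, j⟩ h => P.part_nonempty.1 ⟨j, (mk_mem_edges.1 h).1⟩
  snd_mem := fun ⟨i, _⟩ h => P.part_subset i (mk_mem_edges.1 h).1
  fst_lt_snd := fun ⟨_, _⟩ h => (mk_mem_edges.1 h).2.1
  fst_injOn := by
    rintro ⟨i, j⟩ h ⟨_, j'⟩ h' rfl
    obtain ⟨hj, hij, hbetween⟩ := mk_mem_edges.1 h
    obtain ⟨hj', hij', hbetween'⟩ := mk_mem_edges.1 h'
    have := hbetween j' hj'
    have := hbetween' j hj
    ext <;> grind
  snd_injOn := by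
    rintro ⟨i, j⟩ h ⟨i', _⟩ h' rfl
    obtain ⟨hj, hij, hbetween⟩ := mk_mem_edges.1 h
    obtain ⟨hj', hij', hbetween'⟩ := mk_mem_edges.1 h'
    have hpart : P.part i = P.part i' :=
      (part_eq_part_of_mem_part hj).symm.trans (part_eq_part_of_mem_part hj')
    have hi : i ∈ P.part i := P.mem_part_self.2 (P.part_nonempty.1 ⟨_, hj⟩)
    have hi' : i' ∈ P.part i' := P.mem_part_self.2 (P.part_nonempty.1 ⟨_, hj'⟩)
    have := hbetween i' (hpart ▸ hi')
    have := hbetween' i (hpart ▸ hi)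
    ext <;> grind

/-- The equivalence relation whose classes are the connected components of the graph with arc
set `E`. -/
def componentSetoid (E : Finset (ℕ × ℕ)) : Setoid ℕ :=
  Relation.EqvGen.setoid fun i j => (i, j) ∈ E

open Classical in
/-- The set partition of `s` into the connected components of the graph with arc set `E`, the
inverse of `edges` on arc diagrams. -/
noncomputable def componentPartition (s : Finset ℕ) (E : Finset (ℕ × ℕ)) : Finpartition s :=
  Finpartition.ofSetSetoid (componentSetoid E) s

theorem mem_part_componentPartition {E : Finset (ℕ × ℕ)} {x y : ℕ} :
    y ∈ (componentPartition s E).part x ↔ x ∈ s ∧ y ∈ s ∧ componentSetoid E x y := by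
  unfold componentPartition
  convert Finpartition.mem_part_ofSetSetoid_iff_rel s

theorem finpartition_ext_part {α : Type*} [DecidableEq α] {s : Finset α} {P Q : Finpartition s}
    (h : ∀ x ∈ s, P.part x = Q.part x) : P = Q := by
  have parts_eq (P : Finpartition s) : (P.parts : Set (Finset α)) = P.part '' s :=
    (P.part_surjOn.image_eq_of_mapsTo fun _ hx => P.part_mem.2 hx).symm
  refine Finpartition.ext (coe_injective ?_)
  rw [parts_eq, parts_eq, Set.image_congr h]

theorem part_eq_part_of_componentSetoid_edges {P : Finpartition s} {x y : ℕ}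
    (h : componentSetoid (edges P) x y) : P.part x = P.part y :=
  Setoid.eqvGen_le (s := Setoid.ker P.part)
    (fun _ _ h => (part_eq_part_of_mem_part (mk_mem_edges.1 h).1).symm) h

theorem componentSetoid_edges_of_mem_part {P : Finpartition s} {x y : ℕ} (h : y ∈ P.part x) :
    componentSetoid (edges P) x y := by
  wlog hxy : x ≤ y generalizing x y
  · have hx : x ∈ s := P.part_nonempty.1 ⟨y, h⟩
    exact Setoid.symm' _ <| this (part_eq_part_of_mem_part h ▸ P.mem_part_self.2 hx)
      (le_of_not_ge hxy)
  induction y using Nat.strong_induction_on with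
  | _ y ih =>
    obtain rfl | hlt := hxy.eq_or_lt
    · exact Setoid.refl' _ _
    have hx : x ∈ P.part x := P.mem_part_self.2 (P.part_nonempty.1 ⟨y, h⟩)
    obtain ⟨z, hz, hmax⟩ := exists_max_image {k ∈ P.part x | k < y} id
      ⟨x, mem_filter.2 ⟨hx, hlt⟩⟩
    obtain ⟨hzx, hzy⟩ := mem_filter.1 hz
    have hedge : (z, y) ∈ edges P := by
      rw [mk_mem_edges, part_eq_part_of_mem_part hzx]
      exact ⟨h, hzy, fun k hk ⟨hzk, hky⟩ => hzk.not_ge (hmax k (mem_filter.2 ⟨hk, hky⟩))⟩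
    exact Setoid.trans' _ (ih z hzy hzx (hmax x (mem_filter.2 ⟨hx, hlt⟩))) (.rel _ _ hedge)

theorem componentPartition_edges (P : Finpartition s) : componentPartition s (edges P) = P := by
  refine finpartition_ext_part fun x hx => ext fun y => ?_
  rw [mem_part_componentPartition]
  refine ⟨fun ⟨_, hy, hxy⟩ => ?_, fun hy =>
    ⟨hx, P.part_subset x hy, componentSetoid_edges_of_mem_part hy⟩⟩
  rw [part_eq_part_of_componentSetoid_edges hxy]
  exact P.mem_part_self.2 hy

theorem IsArcDiagram.le_of_reflTransGen {E : Finset (ℕ × ℕ)} (hE : IsArcDiagram s E) {x y : ℕ}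
    (h : Relation.ReflTransGen (fun i j => (i, j) ∈ E) x y) : x ≤ y := by
  induction h with
  | refl => rfl
  | tail _ hedge ih => exact ih.trans (hE.fst_lt_snd _ hedge).le

theorem IsArcDiagram.reflTransGen_or_of_componentSetoid {E : Finset (ℕ × ℕ)}
    (hE : IsArcDiagram s E) {x y : ℕ} (h : componentSetoid E x y) :
    Relation.ReflTransGen (fun i j => (i, j) ∈ E) x y ∨
      Relation.ReflTransGen (fun i j => (i, j) ∈ E) y x := by
  have hright : Relator.RightUnique fun i j => (i, j) ∈ E := fun _ _ _ h h' =>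
    congrArg Prod.snd (hE.fst_injOn h h' rfl)
  have hleft : Relator.RightUnique (Function.swap fun i j => (i, j) ∈ E) := fun _ _ _ h h' =>
    congrArg Prod.fst (hE.snd_injOn h h' rfl)
  induction h with
  | rel _ _ h => exact .inl (.single h)
  | refl => exact .inl .refl
  | symm _ _ _ ih => exact ih.symm
  | trans x y z _ _ hxy hyz =>
    obtain hxy | hyx := hxy <;> obtain hyz | hzy := hyz
    · exact .inl (hxy.trans hyz)
    · exact (Relation.ReflTransGen.total_of_right_unique hleft hxy.swap hzy.swap).symm.imp
        (·.swap) (·.swap)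
    · exact Relation.ReflTransGen.total_of_right_unique hright hyx hyz
    · exact .inr (hzy.trans hyx)

theorem IsArcDiagram.exists_arc_of_componentSetoid {E : Finset (ℕ × ℕ)} (hE : IsArcDiagram s E)
    {x y : ℕ} (h : componentSetoid E x y) (hxy : x < y) :
    ∃ z ≤ y, (x, z) ∈ E := by
  obtain h | h := hE.reflTransGen_or_of_componentSetoid h
  · obtain rfl | ⟨z, hxz, hzy⟩ := h.cases_head
    · exact absurd hxy (lt_irrefl _)
    · exact ⟨z, hE.le_of_reflTransGen hzy, hxz⟩
  · exact absurd hxy (hE.le_of_reflTransGen h).not_gt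

theorem IsArcDiagram.edges_componentPartition {E : Finset (ℕ × ℕ)} (hE : IsArcDiagram s E) :
    edges (componentPartition s E) = E := by
  ext ⟨i, j⟩
  simp only [mk_mem_edges, mem_part_componentPartition]
  constructor
  · rintro ⟨⟨hi, -, hij⟩, hlt, hbetween⟩
    obtain ⟨k, hkj, hik⟩ := hE.exists_arc_of_componentSetoid hij hlt
    obtain rfl | hkj := hkj.eq_or_lt
    · exact hik
    · exact absurd ⟨hE.fst_lt_snd _ hik, hkj⟩
        (hbetween k ⟨hi, hE.snd_mem _ hik, .rel _ _ hik⟩)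
  · intro hij
    refine ⟨⟨hE.fst_mem _ hij, hE.snd_mem _ hij, .rel _ _ hij⟩, hE.fst_lt_snd _ hij, ?_⟩
    rintro k ⟨-, -, hik⟩ ⟨hltk, hkj⟩
    obtain ⟨l, hlk, hil⟩ := hE.exists_arc_of_componentSetoid hik hltk
    obtain rfl : l = j := congrArg Prod.snd (hE.fst_injOn hil hij rfl)
    exact hkj.not_ge hlk

theorem sum_edges_eq_sum_arcDiagrams {M : Type*} [AddCommMonoid M] (f : Finset (ℕ × ℕ) → M) :
    ∑ P : Finpartition s, f (edges P) = ∑ E ∈ arcDiagrams s, f E :=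
  sum_bij' (fun P _ => edges P) (fun E _ => componentPartition s E)
    (fun P _ => mem_arcDiagrams.2 (isArcDiagram_edges P)) (fun _ _ => mem_univ _)
    (fun P _ => componentPartition_edges P)
    (fun _ hE => (mem_arcDiagrams.1 hE).edges_componentPartition) (fun _ _ => rfl)

end Edges

section Statistics

/-- The number of crossings of the arcs `E` together with arcs from the elements of `O` to a
common endpoint at infinity. -/
def crossings (E : Finset (ℕ × ℕ)) (O : Finset ℕ) : ℕ :=
  #{e ∈ E ×ˢ E | e.1.1 < e.2.1 ∧ e.2.1 < e.1.2 ∧ e.1.2 < e.2.2} +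
    #{e ∈ E ×ˢ O | e.1.1 < e.2 ∧ e.2 < e.1.2}

/-- The number of nestings of the arcs `E` together with arcs from the elements of `O` to a
common endpoint at infinity. -/
def nestings (E : Finset (ℕ × ℕ)) (O : Finset ℕ) : ℕ :=
  #{e ∈ E ×ˢ E | e.1.1 < e.2.1 ∧ e.2.1 < e.2.2 ∧ e.2.2 < e.1.2} +
    #{e ∈ E ×ˢ O | e.2 < e.1.1 ∧ e.1.1 < e.1.2}

theorem crossings_edges {s : Finset ℕ} (P : Finpartition s) : crossings (edges P) ∅ = cr P := by
  simp [crossings, cr]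

theorem nestings_edges {s : Finset ℕ} (P : Finpartition s) : nestings (edges P) ∅ = ne P := by
  simp [nestings, ne]

variable {E : Finset (ℕ × ℕ)} {O : Finset ℕ} {a i : ℕ}

theorem crossings_insert_open (hE : ∀ e ∈ E, e.2 ≤ a) :
    crossings E (insert a O) = crossings E O := by
  unfold crossings
  congr 2
  ext ⟨e, o⟩
  have := hE e
  simp only [mem_filter, mem_product, mem_insert]
  grind

theorem nestings_insert_open (hE : ∀ e ∈ E, e.2 ≤ a) :
    nestings E (insert a O) = nestings E O := by
  unfold nestings
  congr 2
  ext ⟨e, o⟩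
  have := hE e
  simp only [mem_filter, mem_product, mem_insert]
  grind

theorem crossings_close (hE : ∀ e ∈ E, e.2 < a) (hO : ∀ o ∈ O, o < a) (hi : i ∈ O) :
    crossings (insert (i, a) E) (O.erase i) = crossings E O + #{o ∈ O | i < o} := by
  have harc : (i, a) ∉ E := fun h => (hE _ h).false
  have hold : ∀ e ∈ E, (if e.1 < i ∧ i < e.2 ∧ e.2 < a then 1 else 0) =
      if e.1 < i ∧ i < e.2 then 1 else 0 := fun e he => if_congr (by grind) rfl rfl
  have hnew : ∑ f ∈ E, (if i < f.1 ∧ f.1 < a ∧ a < f.2 then 1 else 0) = 0 :=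
    sum_eq_zero fun f hf => if_neg (by grind)
  have hopen : ∑ o ∈ O.erase i, (if i < o ∧ o < a then 1 else 0) = #{o ∈ O | i < o} := by
    rw [card_filter, ← add_sum_erase O _ hi, if_neg (lt_irrefl i), zero_add]
    exact sum_congr rfl fun o ho => if_congr (by grind) rfl rfl
  simp only [crossings, card_filter, sum_product, sum_insert harc, hnew, hopen, lt_irrefl,
    and_false, if_false, sum_add_distrib, sum_congr rfl hold, ← add_sum_erase O _ hi]
  ring

theorem nestings_close (hE : ∀ e ∈ E, e.2 < a) (hi : i ∈ O) (hia : i < a) :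
    nestings (insert (i, a) E) (O.erase i) = nestings E O + #{o ∈ O | o < i} := by
  have harc : (i, a) ∉ E := fun h => (hE _ h).false
  have hold : ∑ e ∈ E, (if e.1 < i ∧ i < a ∧ a < e.2 then 1 else 0) = 0 :=
    sum_eq_zero fun e he => if_neg (by grind)
  have hnew : ∀ f ∈ E, (if i < f.1 ∧ f.1 < f.2 ∧ f.2 < a then 1 else 0) =
      if i < f.1 ∧ f.1 < f.2 then 1 else 0 := fun f hf => if_congr (by grind) rfl rfl
  have hopen : ∑ o ∈ O.erase i, (if o < i ∧ i < a then 1 else 0) = #{o ∈ O | o < i} := by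
    rw [card_filter, ← add_sum_erase O _ hi, if_neg (lt_irrefl i), zero_add]
    exact sum_congr rfl fun o _ => if_congr (by grind) rfl rfl
  simp only [nestings, card_filter, sum_product, sum_insert harc, hold, hopen, lt_irrefl,
    and_false, if_false, sum_add_distrib, sum_congr rfl hnew, ← add_sum_erase O _ hi]
  ring

end Statistics

section OpenSums

theorem sum_sum_powersetCard_erase {α M : Type*} [DecidableEq α] [AddCommMonoid M]
    (S : Finset α) (k : ℕ) (f : α → Finset α → M) :
    ∑ i ∈ S, ∑ O ∈ powersetCard k (S.erase i), f i O =
      ∑ O ∈ powersetCard (k + 1) S, ∑ i ∈ O, f i (O.erase i) := by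
  rw [sum_sigma', sum_sigma']
  refine sum_bij' (fun x _ => ⟨insert x.1 x.2, x.1⟩) (fun x _ => ⟨x.2, x.1.erase x.2⟩)
    ?_ ?_ ?_ ?_ ?_
  all_goals
    rintro ⟨x, y⟩ h
    simp only [mem_sigma, mem_powersetCard, subset_erase] at h ⊢
  · grind
  · grind
  · rw [erase_insert h.2.1.2]
  · rw [insert_erase h.2]
  · rw [erase_insert h.2.1.2]

variable {R : Type*} [CommRing R] (p q : R) {E : Finset (ℕ × ℕ)} {S : Finset ℕ} {a : ℕ}

/-- The sum of `p ^ crossings * q ^ nestings` over all ways to add to the arcs `E` arcs to infinity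
from `k` elements of `S`. -/
def openSum (E : Finset (ℕ × ℕ)) (S : Finset ℕ) (k : ℕ) : R :=
  ∑ O ∈ powersetCard k S, p ^ crossings E O * q ^ nestings E O

theorem openSum_zero (E : Finset (ℕ × ℕ)) (S : Finset ℕ) :
    openSum p q E S 0 = p ^ crossings E ∅ * q ^ nestings E ∅ := by
  simp [openSum]

theorem openSum_insert_succ (hE : ∀ e ∈ E, e.2 ≤ a) (ha : a ∉ S) (k : ℕ) :
    openSum p q E (insert a S) (k + 1) = openSum p q E S (k + 1) + openSum p q E S k := by
  have hnotMem : ∀ O ∈ powersetCard k S, a ∉ O := fun O hO haO =>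
    ha ((mem_powersetCard.1 hO).1 haO)
  have hdisj : Disjoint (powersetCard (k + 1) S) ((powersetCard k S).image (insert a)) := by
    rw [disjoint_right]
    rintro _ hO hO'
    obtain ⟨O, -, rfl⟩ := mem_image.1 hO
    exact ha ((mem_powersetCard.1 hO').1 (mem_insert_self a O))
  have hinj : Set.InjOn (insert a) (powersetCard k S : Set (Finset ℕ)) := fun O hO O' hO' h => by
    rw [← erase_insert (hnotMem O hO), h, erase_insert (hnotMem O' hO')]
  simp only [openSum, powersetCard_succ_insert ha, sum_union hdisj, sum_image hinj,
    crossings_insert_open hE, nestings_insert_open hE]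

theorem sum_openSum_close (hE : ∀ e ∈ E, e.2 < a) (hS : ∀ x ∈ S, x < a) (k : ℕ) :
    ∑ i ∈ S, openSum p q (insert (i, a) E) (S.erase i) k =
      pqNat p q (k + 1) * openSum p q E S (k + 1) := by
  simp only [openSum, mul_sum]
  rw [sum_sum_powersetCard_erase S k fun i O =>
    p ^ crossings (insert (i, a) E) O * q ^ nestings (insert (i, a) E) O]
  refine sum_congr rfl fun O hO => ?_
  obtain ⟨hOS, hcard⟩ := mem_powersetCard.1 hO
  have hOa : ∀ o ∈ O, o < a := fun o ho => hS o (hOS ho)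
  rw [← hcard, ← sum_pow_card_gt_mul_pow_card_lt, sum_mul]
  refine sum_congr rfl fun i hi => ?_
  rw [crossings_close hE hOa hi, nestings_close hE hi (hOa i hi)]
  ring

/-- The sum of `p ^ crossings * q ^ nestings` over all arc diagrams on `s` with `k` additional arcs
to infinity, each from its own sink. -/
noncomputable def diagramSum (s : Finset ℕ) (k : ℕ) : R :=
  ∑ E ∈ arcDiagrams s, openSum p q E (sinks s E) k

variable {s : Finset ℕ}

theorem sum_finpartition_eq_diagramSum (s : Finset ℕ) :
    ∑ P : Finpartition s, p ^ cr P * q ^ ne P = diagramSum p q s 0 := by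
  simp only [diagramSum, openSum_zero, ← sum_edges_eq_sum_arcDiagrams, crossings_edges,
    nestings_edges]

theorem diagramSum_insert (ha : ∀ x ∈ s, x < a) (k : ℕ) :
    diagramSum p q (insert a s) k = ∑ E ∈ arcDiagrams s,
      (openSum p q E (insert a (sinks s E)) k +
        ∑ i ∈ sinks s E, openSum p q (insert (i, a) E) (insert a ((sinks s E).erase i)) k) := by
  rw [diagramSum, sum_arcDiagrams_insert ha]
  refine sum_congr rfl fun E hE => ?_
  have hstart : ∀ e ∈ E, e.1 ≠ a := fun e he => (ha _ ((mem_arcDiagrams.1 hE).fst_mem e he)).ne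
  rw [sinks_insert hstart]
  congr 1
  refine sum_congr rfl fun i hi => ?_
  rw [sinks_insert_arc, sinks_insert hstart, erase_insert_of_ne (ha i (mem_sinks.1 hi).1).ne']

theorem diagramSum_insert_zero (ha : ∀ x ∈ s, x < a) :
    diagramSum p q (insert a s) 0 = diagramSum p q s 0 + pqNat p q 1 * diagramSum p q s 1 := by
  rw [diagramSum_insert p q ha, diagramSum, diagramSum, mul_sum, ← sum_add_distrib]
  refine sum_congr rfl fun E hE => ?_
  have hclose := sum_openSum_close p q (S := sinks s E)
    ((mem_arcDiagrams.1 hE).snd_lt ha) (fun i hi => ha i (mem_sinks.1 hi).1) 0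
  simpa only [openSum_zero, add_right_inj] using hclose

theorem diagramSum_insert_succ (ha : ∀ x ∈ s, x < a) (k : ℕ) :
    diagramSum p q (insert a s) (k + 1) = diagramSum p q s k +
      (pqNat p q (k + 1) + 1) * diagramSum p q s (k + 1) +
      pqNat p q (k + 2) * diagramSum p q s (k + 2) := by
  rw [diagramSum_insert p q ha]
  simp only [diagramSum, mul_sum, ← sum_add_distrib]
  refine sum_congr rfl fun E hE => ?_
  have hlt : ∀ e ∈ E, e.2 < a := (mem_arcDiagrams.1 hE).snd_lt ha
  have hsinks : ∀ i ∈ sinks s E, i < a := fun i hi => ha i (mem_sinks.1 hi).1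
  have ha_sinks : a ∉ sinks s E := fun h => (hsinks a h).false
  have hclose : ∀ i ∈ sinks s E,
      openSum p q (insert (i, a) E) (insert a ((sinks s E).erase i)) (k + 1) =
        openSum p q (insert (i, a) E) ((sinks s E).erase i) (k + 1) +
          openSum p q (insert (i, a) E) ((sinks s E).erase i) k := fun i _ =>
    openSum_insert_succ p q ((forall_mem_insert ..).2 ⟨le_rfl, fun e he => (hlt e he).le⟩)
      (fun h => ha_sinks (mem_of_mem_erase h)) k
  rw [sum_congr rfl hclose, sum_add_distrib, sum_openSum_close p q hlt hsinks,
    sum_openSum_close p q hlt hsinks, openSum_insert_succ p q (fun e he => (hlt e he).le) ha_sinks]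
  ring

theorem diagramSum_eq_motzkinWeight (s : Finset ℕ) (k : ℕ) :
    diagramSum p q s k =
      motzkinWeight (fun k => pqNat p q k + 1) (fun k => pqNat p q (k + 1)) #s k := by
  induction s using Finset.induction_on_max generalizing k with
  | empty =>
    cases k <;> simp [diagramSum, arcDiagrams_empty, openSum, sinks, crossings, nestings,
      motzkinWeight]
  | insert a s ha ih =>
    rw [card_insert_of_notMem fun h => (ha a h).false]
    cases k with
    | zero => rw [diagramSum_insert_zero p q ha, ih, ih, motzkinWeight]; simp [pqNat]
    | succ k => rw [diagramSum_insert_succ p q ha, ih, ih, ih, motzkinWeight]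

theorem sum_finpartition_eq_motzkinWeight (s : Finset ℕ) :
    ∑ P : Finpartition s, p ^ cr P * q ^ ne P =
      motzkinWeight (fun k => pqNat p q k + 1) (fun k => pqNat p q (k + 1)) #s 0 := by
  rw [sum_finpartition_eq_diagramSum, diagramSum_eq_motzkinWeight]

theorem crNePoly_eq_motzkinWeight (n : ℕ) :
    crNePoly p q n =
      motzkinWeight (fun k => pqNat p q k + 1) (fun k => pqNat p q (k + 1)) n 0 := by
  rw [crNePoly, sum_finpartition_eq_motzkinWeight, Nat.card_Icc, Nat.add_sub_cancel]

theorem crNePoly_comm (n : ℕ) : crNePoly p q n = crNePoly q p n := by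
  simp only [crNePoly_eq_motzkinWeight, pqNat_comm p q]

end OpenSums

end CrossNest

theorem mainTheorem8 {R : Type*} [CommRing R] (p q : R) :
    PowerSeries.mk (fun n => CrossNest.crNePoly p q n) =
        PowerSeries.mk (fun n => CrossNest.crNePoly q p n) ∧
      CrossNest.HasJFraction (PowerSeries.mk (fun n => CrossNest.crNePoly p q n))
        (fun k => CrossNest.pqNat p q k + 1) (fun k => CrossNest.pqNat p q (k + 1)) := by
  refine ⟨by simp only [CrossNest.crNePoly_comm p q], ?_⟩
  simp only [CrossNest.crNePoly_eq_motzkinWeight]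
  exact CrossNest.hasJFraction_motzkinSeries _ _
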